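/- Let $R$ be an associative ring with $1$ that is left and right noetherian and semiperfect (that is, $R/J(R)$ is semisimple, where $J(R)$ is the Jacobson radical, and idempotents lift modulo $J(R)$). Then $R$ is isomorphic to a finite direct product of blocks, i.e. of nonzero rings that are not isomorphic to a product of two nonzero rings, such that for each block $B$ the following holds; here "module" means left or right module. (1) If $B$ has a finite simple module (left or right), then all left and all right $B$-modules of finite length are finite. In this case the following are equivalent: every simple left $B$-module $S$ has the same cardinality as its endomorphism ring $\mathrm{End}_B(S)$; every simple right $B$-module has the same cardinality as its endomorphism ring; $B$ is basic, i.e. all $\mu_i$ are equal to $1$ in the Wedderburn–Artin decomposition $B/J(B)\cong M_{\mu_1}(D_1)\times\dots\times M_{\mu_n}(D_n)$ with division rings $D_i$. (2) If $B$ has no finite simple module (left or right), then there is an infinite cardinal $\kappa$ such that every nonzero left or right $B$-module of finite length has cardinality $\kappa$, and the endomorphism ring of every simple left or right $B$-module has cardinality $\kappa$. (3) The endomorphism rings of all simple left and right $B$-modules have the same characteristic. -/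

import Mathlib

open scoped Cardinal

universe u

/-- A ring is semiperfect if it is semilocal (its quotient by the Jacobson radical is semisimple)
and idempotents can be lifted modulo the Jacobson radical. -/
def IsSemiperfectRing (R : Type u) [Ring R] : Prop :=
  IsSemisimpleRing (R ⧸ Ring.jacobson R) ∧
    ∀ a : R ⧸ Ring.jacobson R, IsIdempotentElem a →
      ∃ e : R, IsIdempotentElem e ∧ Ideal.Quotient.mk (Ring.jacobson R) e = a

/-- A ring is indecomposable if it is nonzero and not isomorphic to a direct product of two
nonzero rings. -/
def IsIndecomposableRing (B : Type u) [Ring B] : Prop :=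
  Nontrivial B ∧
    ∀ (A C : Type u) [Ring A] [Ring C], Nonempty (B ≃+* A × C) → Subsingleton A ∨ Subsingleton C

/-- A (semiperfect) ring `B` is basic if all the matrix sizes `μ i` in the Wedderburn–Artin
decomposition `B / J(B) ≅ M_{μ 1}(D 1) × ⋯ × M_{μ n}(D n)`, with division rings `D i`,
are equal to `1`. -/
def IsBasicRing (B : Type u) [Ring B] : Prop :=
  ∃ (n : ℕ) (μ : Fin n → ℕ) (D : Fin n → Type u) (_ : ∀ i, DivisionRing (D i)),
    Nonempty ((B ⧸ Ring.jacobson B) ≃+* (∀ i, Matrix (Fin (μ i)) (Fin (μ i)) (D i))) ∧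
      ∀ i, μ i = 1

/-- `B` has a finite simple left module. For right modules, apply this to `Bᵐᵒᵖ`. -/
def HasFiniteSimpleModule (B : Type u) [Ring B] : Prop :=
  ∃ (S : Type u) (_ : AddCommGroup S) (_ : Module B S), IsSimpleModule B S ∧ Finite S

/-- All left `B`-modules of finite length are finite. -/
def FiniteLengthModulesFinite (B : Type u) [Ring B] : Prop :=
  ∀ (M : Type u) [AddCommGroup M] [Module B M], IsFiniteLength B M → Finite M

/-- Every simple left `B`-module has the same cardinality as its endomorphism ring. -/
def SimpleCardEqEnd (B : Type u) [Ring B] : Prop :=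
  ∀ (S : Type u) [AddCommGroup S] [Module B S], IsSimpleModule B S → #S = #(Module.End B S)

/-- All nonzero left `B`-modules of finite length have cardinality `κ`. -/
def FiniteLengthModulesCard (B : Type u) [Ring B] (κ : Cardinal.{u}) : Prop :=
  ∀ (M : Type u) [AddCommGroup M] [Module B M], Nontrivial M → IsFiniteLength B M → #M = κ

/-- The endomorphism rings of all simple left `B`-modules have cardinality `κ`. -/
def SimpleEndCard (B : Type u) [Ring B] (κ : Cardinal.{u}) : Prop :=
  ∀ (S : Type u) [AddCommGroup S] [Module B S], IsSimpleModule B S → #(Module.End B S) = κ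

/-- The endomorphism rings of all simple left `B`-modules have characteristic `c`. -/
def SimpleEndChar (B : Type u) [Ring B] (c : ℕ) : Prop :=
  ∀ (S : Type u) [AddCommGroup S] [Module B S], IsSimpleModule B S → CharP (Module.End B S) c

/-! Noetherian induction splits `R` into blocks. For a block $B$ write $B/J\cong\prod
M_{\mu_i}(D_i)$. The simple left modules are the column spaces $D_i^{\mu_i}$, with endomorphism
rings equipotent to $D_i$; right modules are handled over the opposite rings. So everything reduces
to one claim: the $D_i$ share their characteristic, and are either all finite or all infinite of one
cardinality. The invariant `charCard` records this.

Bimodules link the factors. A nonzero group that is a finitely generated left module over $M_m(D)$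
and a finitely generated right module over $M_{m'}(D')$ reveals characteristic and size of $D$ and
of $D'$, so these agree (`charCard_eq_of_mul_eq_zero`). Such a bimodule exists near each nonzero
$x\in eBe'$ (`exists_charCard_eq`): modulo a two-sided ideal maximal among those omitting $x$,
Nakayama on both sides gives $Jx=xJ=0$, and a Peirce component of $x$ generates the bimodule. Now
let $e$ be an idempotent lifting the sum of the identities of all factors with one invariant. Then
$eB(1-e)=(1-e)Be=0$, so $e$ is central, and indecomposability leaves only one invariant. -/

/-! ### The Jacobson radical and its left-right symmetry -/

theorem Ring.mem_jacobson_iff_exists {R : Type*} [Ring R] {x : R} :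
    x ∈ Ring.jacobson R ↔ ∀ y, ∃ z, z * (1 + y * x) = 1 := by
  rw [← Ideal.jacobson_bot, Ideal.mem_jacobson_iff]
  simp [sub_eq_zero, mul_add, mul_assoc, add_comm]

/-- A left inverse $w$ of $1+xy$ equals $1-w(xy)$, so it is left invertible as well and hence a
two-sided inverse. -/
theorem Ring.op_mem_jacobson {R : Type*} [Ring R] {x : R} (hx : x ∈ Ring.jacobson R) :
    MulOpposite.op x ∈ Ring.jacobson Rᵐᵒᵖ := by
  rw [Ring.mem_jacobson_iff_exists]
  intro y
  have hxy : x * y.unop ∈ Ring.jacobson R := Ideal.mul_mem_right _ _ hx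
  obtain ⟨w, hw⟩ := Ring.mem_jacobson_iff_exists.1 hxy 1
  rw [one_mul] at hw
  obtain ⟨v, hv⟩ := Ring.mem_jacobson_iff_exists.1 hxy (-w)
  have hv' : v * w = 1 := by
    have : 1 + -w * (x * y.unop) = w := by
      rw [neg_mul, ← sub_eq_add_neg, sub_eq_iff_eq_add, ← hw, mul_add, mul_one]
    rwa [this] at hv
  have : v = 1 + x * y.unop := left_inv_eq_right_inv hv' hw
  refine ⟨MulOpposite.op w, MulOpposite.unop_injective ?_⟩
  simpa [← this] using hv'

theorem Ring.map_mem_jacobson {R S : Type*} [Ring R] [Ring S] {f : R →+* S}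
    (hf : Function.Surjective f) {x : R} (hx : x ∈ Ring.jacobson R) : f x ∈ Ring.jacobson S :=
  haveI : RingHomSurjective f := ⟨hf⟩
  Ring.le_comap_jacobson f hx

/-! ### Semiperfect rings and the block decomposition -/

theorem IsSemiperfectRing.exists_isIdempotentElem {R : Type u} [Ring R] (h : IsSemiperfectRing R)
    {a : R} (ha : a * a - a ∈ Ring.jacobson R) :
    ∃ e, IsIdempotentElem e ∧ e - a ∈ Ring.jacobson R := by
  obtain ⟨e, he, hea⟩ := h.2 (Ideal.Quotient.mk _ a) (by
    rw [IsIdempotentElem, ← map_mul]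
    exact Ideal.Quotient.eq.2 ha)
  exact ⟨e, he, Ideal.Quotient.eq.1 hea⟩

theorem IsSemiperfectRing.of_ringEquiv_prod {R A C : Type u} [Ring R] [Ring A] [Ring C]
    (e : R ≃+* A × C) (h : IsSemiperfectRing R) : IsSemiperfectRing A := by
  let f : R →+* A := (RingHom.fst A C).comp e.toRingHom
  have hf : Function.Surjective f := fun a ↦ ⟨e.symm (a, 0), by simp [f]⟩
  constructor
  · have := h.1
    exact RingHom.isSemisimpleRing_of_surjective
      (Ideal.quotientMap (Ring.jacobson A) f fun _ hx ↦ Ring.map_mem_jacobson hf hx)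
      (Ideal.quotientMap_surjective hf)
  · intro b hb
    obtain ⟨a, rfl⟩ := Ideal.Quotient.mk_surjective b
    have ha : a * a - a ∈ Ring.jacobson A := Ideal.Quotient.eq.1 (by rw [map_mul]; exact hb)
    -- Padding by `0` in the second factor gives an element of `R` that is idempotent modulo the
    -- radical; its lift is then projected to `A`.
    have hr : e.symm (a, 0) * e.symm (a, 0) - e.symm (a, 0) ∈ Ring.jacobson R := by
      rw [← map_mul, ← map_sub, Ring.mem_jacobson_iff_exists]
      intro y
      obtain ⟨z, hz⟩ := Ring.mem_jacobson_iff_exists.1 ha (e y).1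
      refine ⟨e.symm (z, 1), e.injective ?_⟩
      ext <;> simp [hz]
    obtain ⟨g, hg, hga⟩ := h.exists_isIdempotentElem hr
    refine ⟨f g, hg.map f, Ideal.Quotient.eq.2 ?_⟩
    simpa [f] using Ring.map_mem_jacobson hf hga

theorem IsSemiperfectRing.of_ringEquiv_prod_right {R A C : Type u} [Ring R] [Ring A] [Ring C]
    (e : R ≃+* A × C) (h : IsSemiperfectRing R) : IsSemiperfectRing C :=
  h.of_ringEquiv_prod (e.trans RingEquiv.prodComm)

/-- A quotient of a left noetherian ring that is semiperfect is a finite product of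
indecomposable semiperfect quotients. -/
theorem exists_ringEquiv_pi_isIndecomposableRing {R : Type u} [Ring R] [IsNoetherianRing R]
    {A : Type u} [Ring A] (f : R →+* A) (hf : Function.Surjective f) (hA : IsSemiperfectRing A) :
    ∃ (ι : Type) (_ : Finite ι) (B : ι → Type u) (_ : ∀ i, Ring (B i)),
      Nonempty (A ≃+* (∀ i, B i)) ∧ ∀ i, IsIndecomposableRing (B i) ∧ IsSemiperfectRing (B i) ∧
        ∃ g : R →+* B i, Function.Surjective g := by
  -- Each proper splitting of a quotient of `R` strictly enlarges both kernels, so splitting stops.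
  induction hI : RingHom.ker f using WellFoundedGT.induction generalizing A with
  | ind I ih =>
  by_cases hn : Nontrivial A
  swap
  · rw [not_nontrivial_iff_subsingleton] at hn
    exact ⟨Empty, inferInstance, fun _ ↦ PUnit, fun _ ↦ inferInstance,
      ⟨{ toFun := fun _ _ ↦ 0, invFun := fun _ ↦ 0, left_inv := fun _ ↦ Subsingleton.elim _ _,
         right_inv := fun _ ↦ Subsingleton.elim _ _, map_mul' := fun _ _ ↦ Subsingleton.elim _ _,
         map_add' := fun _ _ ↦ Subsingleton.elim _ _ }⟩, fun i ↦ i.elim⟩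
  by_cases hind : IsIndecomposableRing A
  · exact ⟨Unit, inferInstance, fun _ ↦ A, fun _ ↦ inferInstance,
      ⟨(RingEquiv.piUnique fun _ : Unit ↦ A).symm⟩, fun _ ↦ ⟨hind, hA, f, hf⟩⟩
  · simp only [IsIndecomposableRing, hn, true_and] at hind
    push Not at hind
    obtain ⟨A₁, A₂, _, _, ⟨e⟩, h₁, h₂⟩ := hind
    have key₁ : I < RingHom.ker ((RingHom.fst A₁ A₂).comp (e.toRingHom.comp f)) := by
      rw [← hI]
      refine lt_of_le_of_ne (fun x hx ↦ ?_) fun h ↦ ?_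
      · rw [RingHom.mem_ker] at hx
        simp [RingHom.mem_ker, hx]
      · obtain ⟨r, hr⟩ := hf (e.symm (0, 1))
        have : r ∈ RingHom.ker f := by rw [h]; simp [RingHom.mem_ker, hr]
        simp [RingHom.mem_ker, hr] at this
    have key₂ : I < RingHom.ker ((RingHom.snd A₁ A₂).comp (e.toRingHom.comp f)) := by
      rw [← hI]
      refine lt_of_le_of_ne (fun x hx ↦ ?_) fun h ↦ ?_
      · rw [RingHom.mem_ker] at hx
        simp [RingHom.mem_ker, hx]
      · obtain ⟨r, hr⟩ := hf (e.symm (1, 0))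
        have : r ∈ RingHom.ker f := by rw [h]; simp [RingHom.mem_ker, hr]
        simp [RingHom.mem_ker, hr] at this
    obtain ⟨ι₁, _, B₁, _, ⟨e₁⟩, hB₁⟩ := ih _ key₁ _
      (Prod.fst_surjective.comp (e.surjective.comp hf)) (hA.of_ringEquiv_prod e) rfl
    obtain ⟨ι₂, _, B₂, _, ⟨e₂⟩, hB₂⟩ := ih _ key₂ _
      (Prod.snd_surjective.comp (e.surjective.comp hf)) (hA.of_ringEquiv_prod_right e) rfl
    let inst : ∀ i, Ring (Sum.elim B₁ B₂ i) := fun i ↦ by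
      cases i <;> dsimp only [Sum.elim_inl, Sum.elim_inr] <;> infer_instance
    refine ⟨ι₁ ⊕ ι₂, inferInstance, Sum.elim B₁ B₂, inst,
      ⟨(e.trans (e₁.prodCongr e₂)).trans
        { (Equiv.sumPiEquivProdPi (Sum.elim B₁ B₂)).symm with
          map_mul' := fun x y ↦ ?_, map_add' := fun x y ↦ ?_ }⟩, ?_⟩
    · ext (i | i) <;> rfl
    · ext (i | i) <;> rfl
    · rintro (i | i)
      · exact hB₁ i
      · exact hB₂ i

/-- An idempotent `e` with `e * b * (1 - e) = 0` and `(1 - e) * b * e = 0` for all `b`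
is trivial in an indecomposable ring. -/
theorem IsIndecomposableRing.eq_zero_or_eq_one {B : Type u} [Ring B] (hB : IsIndecomposableRing B)
    {e : B} (he : IsIdempotentElem e) (h₁ : ∀ b, e * b * (1 - e) = 0)
    (h₂ : ∀ b, (1 - e) * b * e = 0) : e = 0 ∨ e = 1 := by
  have hc : ∀ b, e * b = b * e := fun b ↦ by
    have h₁ := h₁ b
    have h₂ := h₂ b
    rw [mul_sub, mul_one, sub_eq_zero] at h₁
    rw [sub_mul, sub_mul, one_mul, sub_eq_zero] at h₂
    rw [h₁, h₂]
  have key : ∀ g : Bool, (fun b : Bool ↦ if b then e else 1 - e) g ∈ Set.center B := by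
    intro g
    rw [Semigroup.mem_center_iff]
    intro b
    cases g <;> simp [mul_sub, sub_mul, hc]
  have hco : CompleteOrthogonalIdempotents (fun b : Bool ↦ if b then e else 1 - e) :=
    { idem := fun b ↦ by cases b <;> simp [he, he.one_sub]
      ortho := fun a b hab ↦ by
        cases a <;> cases b <;> simp_all [mul_sub, sub_mul, he.eq]
      complete := by simp }
  have key' := hB.2 (hco.idem true).Corner (hco.idem false).Corner
    ⟨(hco.ringEquivOfIsMulCentral key).trans
      { toFun := fun x ↦ (x true, x false)
        invFun := fun x b ↦ match b with
          | true => x.1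
          | false => x.2
        left_inv := fun x ↦ by ext (_ | _) <;> rfl
        right_inv := fun x ↦ rfl
        map_mul' := fun _ _ ↦ rfl
        map_add' := fun _ _ ↦ rfl }⟩
  refine key'.imp (fun h ↦ ?_) fun h ↦ ?_
  · exact congrArg Subtype.val (h.elim 1 0)
  · exact (sub_eq_zero.1 (congrArg Subtype.val (h.elim 1 0))).symm

/-! ### Modules over a matrix ring quotient -/

section KilledModules

open Matrix

variable {B : Type*} [Ring B] {m : ℕ} {D : Type u} [DivisionRing D]
  {p : B →+* Matrix (Fin m) (Fin m) D} (hp : Function.Surjective p)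
include hp

/-- If `M_m(D)` is a quotient of `B`, then an integer kills a nonzero `B`-module on which the
kernel of `B → M_m(D)` acts as zero if and only if it vanishes in `D`. -/
theorem natCast_eq_zero_iff_of_surjective_matrix {W : Type*} [AddCommGroup W] [Module B W]
    [Nontrivial W] (hW : ∀ b, p b = 0 → ∀ w : W, b • w = 0) (n : ℕ) :
    (n : D) = 0 ↔ ∀ w : W, n • w = 0 := by
  constructor
  · intro hn w
    have : p (n : B) = 0 := by
      rw [map_natCast]
      ext i j
      by_cases hij : i = j <;> simp [Matrix.natCast_apply, hij, hn]
    rw [← hW _ this w, Nat.cast_smul_eq_nsmul]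
  · intro hn
    by_contra h
    obtain ⟨w, hw⟩ := exists_ne (0 : W)
    obtain ⟨b, hb⟩ := hp (Matrix.scalar (Fin m) (n : D)⁻¹)
    have : p (b * n - 1) = 0 := by
      rw [map_sub, map_mul, map_natCast, map_one, hb, sub_eq_zero,
        ← map_natCast (Matrix.scalar (Fin m)), ← map_mul, inv_mul_cancel₀ h, map_one]
    have := hW _ this w
    rw [sub_smul, mul_smul, one_smul, Nat.cast_smul_eq_nsmul, hn, smul_zero, zero_sub,
      neg_eq_zero] at this
    exact hw this

/-- The difference of two distinct scalars is invertible modulo the kernel of `p`, so it kills no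
nonzero vector. -/
theorem exists_injective_of_surjective_matrix {W : Type*} [AddCommGroup W] [Module B W]
    [Nontrivial W] (hW : ∀ b, p b = 0 → ∀ w : W, b • w = 0) :
    ∃ f : D → W, Function.Injective f := by
  obtain ⟨w, hw⟩ := exists_ne (0 : W)
  choose g hg using hp
  refine ⟨fun d ↦ g (Matrix.scalar _ d) • w, fun d d' h ↦ by_contra fun hd ↦ hw ?_⟩
  have h : (g (Matrix.scalar _ d) - g (Matrix.scalar _ d')) • w = 0 := by
    rw [sub_smul, sub_eq_zero]; exact h
  have key : p (g (Matrix.scalar _ (d - d')⁻¹) *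
      (g (Matrix.scalar _ d) - g (Matrix.scalar _ d')) - 1) = 0 := by
    rw [map_sub, map_mul, map_sub, hg, hg, hg, ← map_sub, ← map_mul,
      inv_mul_cancel₀ (sub_ne_zero.2 hd), map_one, map_one, sub_self]
  have := hW _ key w
  rwa [sub_smul, mul_smul, h, smul_zero, one_smul, zero_sub, neg_eq_zero] at this

theorem exists_surjective_of_surjective_matrix {W : Type*} [AddCommGroup W] [Module B W]
    [Module.Finite B W] (hW : ∀ b, p b = 0 → ∀ w : W, b • w = 0) :
    ∃ (k : ℕ) (f : (Fin k → Matrix (Fin m) (Fin m) D) → W), Function.Surjective f := by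
  obtain ⟨k, s, hs⟩ := Module.Finite.exists_fin (R := B) (M := W)
  choose g hg using hp
  refine ⟨k, fun c ↦ ∑ i, g (c i) • s i, fun w ↦ ?_⟩
  obtain ⟨c, rfl⟩ := (Submodule.mem_span_range_iff_exists_fun B).1 (hs ▸ Submodule.mem_top : w ∈ _)
  refine ⟨fun i ↦ p (c i), Finset.sum_congr rfl fun i _ ↦ ?_⟩
  have := hW (g (p (c i)) - c i) (by rw [map_sub, hg, sub_self]) (s i)
  rwa [sub_smul, sub_eq_zero] at this

theorem finite_iff_of_surjective_matrix {W : Type*} [AddCommGroup W] [Module B W]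
    [Nontrivial W] [Module.Finite B W] (hW : ∀ b, p b = 0 → ∀ w : W, b • w = 0) :
    Finite W ↔ Finite D := by
  obtain ⟨f, hf⟩ := exists_injective_of_surjective_matrix hp hW
  obtain ⟨k, g, hg⟩ := exists_surjective_of_surjective_matrix hp hW
  refine ⟨fun _ ↦ Finite.of_injective f hf, fun _ ↦ ?_⟩
  have : Finite (Matrix (Fin m) (Fin m) D) := inferInstanceAs (Finite (Fin m → Fin m → D))
  exact Finite.of_surjective g hg

/-- `W` lies between `D` and a finite power of `D`, which is no larger because `D` is infinite. -/
theorem mk_eq_of_surjective_matrix {W : Type u} [AddCommGroup W] [Module B W]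
    [Nontrivial W] [Module.Finite B W] [Infinite D]
    (hW : ∀ b, p b = 0 → ∀ w : W, b • w = 0) : #W = #D := by
  obtain ⟨f, hf⟩ := exists_injective_of_surjective_matrix hp hW
  obtain ⟨k, g, hg⟩ := exists_surjective_of_surjective_matrix hp hW
  refine le_antisymm ((Cardinal.mk_le_of_surjective hg).trans ?_) (Cardinal.mk_le_of_injective hf)
  have hD := Cardinal.aleph0_le_mk D
  have pow_le (X : Type u) (hX : #X ≤ #D) (l : ℕ) : #(Fin l → X) ≤ #D := by
    rw [Cardinal.mk_pi]
    simpa using (Cardinal.power_le_power_right hX).trans (Cardinal.power_nat_le hD)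
  exact pow_le _ (pow_le _ (pow_le _ le_rfl m) m) k

/-- A simple `B`-module on which the kernel of `B → M_m(D)` acts as zero is the module of
column vectors. -/
theorem exists_addEquiv_of_isSimpleModule {S : Type*} [AddCommGroup S] [Module B S]
    [IsSimpleModule B S] (hS : ∀ b, p b = 0 → ∀ s : S, b • s = 0) :
    ∃ E : (Fin m → D) ≃+ S, ∀ b v, E (p b *ᵥ v) = b • E v := by
  have hS' : ∀ b b', p b = p b' → ∀ s : S, b • s = b' • s := fun b b' h s ↦ by
    rw [← sub_eq_zero, ← sub_smul]
    exact hS _ (by rw [map_sub, h, sub_self]) s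
  have : Nontrivial S := IsSimpleModule.nontrivial B S
  obtain ⟨t, ht⟩ := exists_ne (0 : S)
  choose g hg using hp
  -- The diagonal matrix units sum to `1`, so one of them does not kill `t`.
  obtain ⟨j, hj⟩ : ∃ j, g (single j j 1) • t ≠ 0 := by
    by_contra! h
    refine ht ?_
    rw [← one_smul B t, hS' 1 (∑ j, g (single j j 1)), Finset.sum_smul, Finset.sum_eq_zero]
    · exact fun j _ ↦ h j
    · rw [map_one, map_sum, ← Matrix.sum_single_one]
      simp [hg]
  set s := g (single j j 1) • t
  -- `M v` carries `v` in column `j`; this column is a copy of the column space, and acting on `s`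
  -- maps it to `S`.
  let M : (Fin m → D) → Matrix (Fin m) (Fin m) D :=
    fun v ↦ Matrix.of fun a c ↦ if c = j then v a else 0
  have hM_mul (A : Matrix (Fin m) (Fin m) D) (v) : A * M v = M (A *ᵥ v) := by
    ext a c
    by_cases hc : c = j <;> simp [M, Matrix.mul_apply, Matrix.mulVec, dotProduct, hc]
  let E : (Fin m → D) →+ S :=
    { toFun := fun v ↦ g (M v) • s
      map_zero' := hS _ (by rw [hg]; ext; simp [M]) _
      map_add' := fun v w ↦ by
        rw [← add_smul]
        refine hS' _ _ ?_ _
        rw [map_add, hg, hg, hg]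
        ext a c
        by_cases hc : c = j <;> simp [M, hc] }
  have hE (b v) : E (p b *ᵥ v) = b • E v := by
    change g (M _) • s = b • g (M v) • s
    rw [← mul_smul b]
    refine hS' _ _ ?_ _
    rw [map_mul, hg, hg, hM_mul]
  have hEs : E (Pi.single j 1) = s := by
    change g (M _) • s = s
    rw [← mul_smul]
    refine hS' _ _ ?_ _
    have hM : M (Pi.single j 1) = single j j 1 := by
      ext a c
      simp only [M, Matrix.of_apply, Matrix.single_apply, Pi.single_apply]
      grind
    rw [map_mul, hg, hg, hM, Matrix.single_mul_single_same, one_mul]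
  refine ⟨AddEquiv.ofBijective E ⟨?_, fun x ↦ ?_⟩, hE⟩
  · rw [injective_iff_map_eq_zero]
    intro v hv
    by_contra hv0
    obtain ⟨k, hk⟩ := Function.ne_iff.1 hv0
    refine hj ?_
    have hk : v k ≠ 0 := hk
    -- This matrix unit moves a nonzero coordinate of `v` to position `j`, scaled to `1`, so `E v =
    -- 0` would force `s = 0`.
    have key := hE (g (single j k (v k)⁻¹)) v
    rwa [hg, Matrix.single_mulVec, inv_mul_cancel₀ hk, hv, smul_zero, ← Pi.single, hEs] at key
  · obtain ⟨b, rfl⟩ := (IsSimpleModule.toSpanSingleton_surjective B hj) x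
    refine ⟨p b *ᵥ Pi.single j 1, ?_⟩
    rw [hE, LinearMap.toSpanSingleton_apply, hEs]

/-- The endomorphisms of the module of column vectors over `D` are the right multiplications
by elements of `D`. -/
theorem nonempty_equiv_end_of_addEquiv [NeZero m] {S : Type*} [AddCommGroup S] [Module B S]
    (E : (Fin m → D) ≃+ S) (hE : ∀ b v, E (p b *ᵥ v) = b • E v) :
    Nonempty (D ≃ Module.End B S) := by
  let F : D → Module.End B S := fun d ↦
    { toFun := fun s ↦ E (fun k ↦ E.symm s k * d)
      map_add' := fun s t ↦ by
        rw [← map_add]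
        congr 1
        ext k
        simp [add_mul]
      map_smul' := fun b s ↦ by
        obtain ⟨v, rfl⟩ := E.surjective s
        rw [← hE, RingHom.id_apply, ← hE]
        congr 1
        ext k
        simp [Matrix.mulVec, dotProduct, Finset.sum_mul, mul_assoc] }
  refine ⟨Equiv.ofBijective F ⟨fun d d' h ↦ ?_, fun φ ↦ ?_⟩⟩
  · have h := congrFun (E.injective (DFunLike.congr_fun h (E fun _ ↦ 1))) 0
    simpa using h
  · refine ⟨E.symm (φ (E (Pi.single 0 1))) 0, LinearMap.ext fun s ↦ ?_⟩
    obtain ⟨v, rfl⟩ := E.surjective s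
    choose g hg using hp
    -- The first basis vector generates, so `φ` is determined by its image there, and only
    -- coordinate `0` of that image enters.
    have hv : v = p (g (Matrix.of fun a c ↦ if c = 0 then v a else 0)) *ᵥ Pi.single 0 1 := by
      rw [hg]
      ext k
      simp
    conv_rhs => rw [hv, hE, map_smul, ← E.apply_symm_apply (φ _), ← hE, hg]
    change E _ = E _
    congr 1
    ext k
    simp [Matrix.mulVec, dotProduct]

end KilledModules

/-! ### The invariant of a division ring -/

open Classical in
/-- The characteristic of a ring together with its cardinality, where finite rings are not
distinguished by their cardinality. -/
noncomputable def charCard (D : Type u) [Ring D] : ℕ × Cardinal.{u} :=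
  (ringChar D, if Finite D then 0 else #D)

theorem charCard_eq {D D' : Type u} [Ring D] [Ring D'] (h : ∀ n : ℕ, (n : D) = 0 ↔ (n : D') = 0)
    (hfin : Finite D ↔ Finite D') (hcard : Infinite D → Infinite D' → #D = #D') :
    charCard D = charCard D' := by
  refine Prod.ext (Nat.dvd_antisymm ?_ ?_) ?_
  · exact (ringChar.spec D _).1 ((h _).2 ((ringChar.spec D' _).2 dvd_rfl))
  · exact (ringChar.spec D' _).1 ((h _).1 ((ringChar.spec D _).2 dvd_rfl))
  · by_cases hD : Finite D
    · simp [charCard, hD, hfin.1 hD]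
    · have hD' : ¬ Finite D' := fun h ↦ hD (hfin.2 h)
      simp [charCard, hD, hD', hcard (not_finite_iff_infinite.1 hD) (not_finite_iff_infinite.1 hD')]

theorem charCard_mulOpposite (D : Type u) [Ring D] : charCard Dᵐᵒᵖ = charCard D :=
  charCard_eq (fun n ↦ by rw [← MulOpposite.op_natCast, MulOpposite.op_eq_zero_iff])
    MulOpposite.opEquiv.finite_iff.symm fun _ _ ↦ Cardinal.mk_congr MulOpposite.opEquiv.symm

theorem ringChar_eq_of_charCard_eq {D D' : Type u} [Ring D] [Ring D']
    (h : charCard D = charCard D') : ringChar D = ringChar D' :=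
  congrArg Prod.fst h

theorem finite_iff_of_charCard_eq {D D' : Type u} [Ring D] [Ring D']
    (h : charCard D = charCard D') : Finite D ↔ Finite D' := by
  have h := congrArg Prod.snd h
  by_cases hD : Finite D <;> by_cases hD' : Finite D' <;>
    simp only [charCard, hD, hD', if_true, if_false] at h ⊢
  -- The marker `0` for finite rings is never the cardinality of a ring.
  · exact absurd h.symm (Cardinal.mk_ne_zero _)
  · exact absurd h (Cardinal.mk_ne_zero _)

theorem mk_eq_of_charCard_eq {D D' : Type u} [Ring D] [Ring D'] [Infinite D]
    (h : charCard D = charCard D') : #D = #D' := by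
  have hD : ¬ Finite D := not_finite_iff_infinite.2 ‹_›
  have hD' : ¬ Finite D' := fun h' ↦ hD ((finite_iff_of_charCard_eq h).2 h')
  have h := congrArg Prod.snd h
  simpa only [charCard, hD, hD', if_false] using h

/-- Division rings over which the same nonzero abelian group arises from finitely generated
modules over matrix rings have the same characteristic and essentially the same cardinality. -/
theorem charCard_eq_of_addEquiv {B B' : Type*} [Ring B] [Ring B'] {m m' : ℕ} {D D' : Type u}
    [DivisionRing D] [DivisionRing D'] {p : B →+* Matrix (Fin m) (Fin m) D}
    {p' : B' →+* Matrix (Fin m') (Fin m') D'} (hp : Function.Surjective p)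
    (hp' : Function.Surjective p') {W W' : Type u} [AddCommGroup W] [AddCommGroup W'] [Module B W]
    [Module B' W'] [Module.Finite B W] [Module.Finite B' W'] [Nontrivial W] (e : W ≃+ W')
    (hW : ∀ b, p b = 0 → ∀ w : W, b • w = 0) (hW' : ∀ b, p' b = 0 → ∀ w : W', b • w = 0) :
    charCard D = charCard D' := by
  have : Nontrivial W' := e.symm.toEquiv.nontrivial
  refine charCard_eq (fun n ↦ ?_) ?_ fun _ _ ↦ ?_
  · rw [natCast_eq_zero_iff_of_surjective_matrix hp hW,
      natCast_eq_zero_iff_of_surjective_matrix hp' hW', e.surjective.forall]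
    simp [← map_nsmul]
  · rw [← finite_iff_of_surjective_matrix hp hW, ← finite_iff_of_surjective_matrix hp' hW']
    exact e.toEquiv.finite_iff
  · rw [← mk_eq_of_surjective_matrix hp hW, ← mk_eq_of_surjective_matrix hp' hW']
    exact Cardinal.mk_congr e.toEquiv

/-! ### Wedderburn factors and their simple modules -/

/-- A family of ring homomorphisms onto matrix rings over division rings that induces an
isomorphism from `B / J(B)` onto their product. -/
structure IsWedderburnFamily {B : Type*} [Ring B] {n : ℕ} {μ : Fin n → ℕ} {D : Fin n → Type u}
    [∀ i, DivisionRing (D i)] (p : ∀ i, B →+* Matrix (Fin (μ i)) (Fin (μ i)) (D i)) : Prop where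
  exists_forall_eq : ∀ m : ∀ i, Matrix (Fin (μ i)) (Fin (μ i)) (D i), ∃ b, ∀ i, p i b = m i
  mem_jacobson : ∀ b, (∀ i, p i b = 0) → b ∈ Ring.jacobson B

theorem isWedderburnFamily_of_ringEquiv {B : Type u} [Ring B] {n : ℕ} {μ : Fin n → ℕ}
    {D : Fin n → Type u} [∀ i, DivisionRing (D i)]
    (e : (B ⧸ Ring.jacobson B) ≃+* ∀ i, Matrix (Fin (μ i)) (Fin (μ i)) (D i)) :
    IsWedderburnFamily fun i ↦
      ((Pi.evalRingHom _ i).comp e.toRingHom).comp (Ideal.Quotient.mk (Ring.jacobson B)) where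
  exists_forall_eq m := by
    obtain ⟨b, hb⟩ := Ideal.Quotient.mk_surjective (e.symm m)
    exact ⟨b, fun i ↦ by simp [hb]⟩
  mem_jacobson b hb := by
    rw [← Ideal.Quotient.eq_zero_iff_mem, ← map_eq_zero_iff e e.injective]
    exact funext hb

/-- The homomorphism from the opposite ring induced by a homomorphism to a matrix ring. -/
def RingHom.opMatrix {B : Type*} [Ring B] {m : ℕ} {D : Type*} [Ring D]
    (p : B →+* Matrix (Fin m) (Fin m) D) : Bᵐᵒᵖ →+* Matrix (Fin m) (Fin m) Dᵐᵒᵖ :=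
  (RingEquiv.mopMatrix (m := Fin m) (α := D)).symm.toRingHom.comp (RingHom.op p)

theorem RingHom.opMatrix_eq_zero_iff {B : Type*} [Ring B] {m : ℕ} {D : Type*} [Ring D]
    (p : B →+* Matrix (Fin m) (Fin m) D) (b : Bᵐᵒᵖ) : p.opMatrix b = 0 ↔ p b.unop = 0 := by
  change RingEquiv.mopMatrix.symm (MulOpposite.op (p b.unop)) = 0 ↔ _
  rw [map_eq_zero_iff _ (RingEquiv.injective _), MulOpposite.op_eq_zero_iff]

namespace IsWedderburnFamily

variable {B : Type*} [Ring B] {n : ℕ} {μ : Fin n → ℕ} {D : Fin n → Type u}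
  [∀ i, DivisionRing (D i)] {p : ∀ i, B →+* Matrix (Fin (μ i)) (Fin (μ i)) (D i)}
  (h : IsWedderburnFamily p)
include h

theorem surjective (i : Fin n) : Function.Surjective (p i) := fun m ↦ by
  obtain ⟨b, hb⟩ := h.exists_forall_eq (Pi.single i m)
  exact ⟨b, by rw [hb, Pi.single_eq_same]⟩

theorem map_eq_zero (i : Fin n) {b : B} (hb : b ∈ Ring.jacobson B) : p i b = 0 := by
  have := Ring.map_mem_jacobson (h.surjective i) hb
  rcases isEmpty_or_nonempty (Fin (μ i)) with _ | _
  · exact Subsingleton.elim _ _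
  · rwa [IsSemisimpleRing.jacobson_eq_bot, Ideal.mem_bot] at this

theorem op : IsWedderburnFamily fun i ↦ (p i).opMatrix where
  exists_forall_eq m := by
    obtain ⟨b, hb⟩ := h.exists_forall_eq fun i ↦ (RingEquiv.mopMatrix (m i)).unop
    exact ⟨MulOpposite.op b, fun i ↦ by
      change RingEquiv.mopMatrix.symm (MulOpposite.op (p i b)) = _
      rw [hb, MulOpposite.op_unop, RingEquiv.symm_apply_apply]⟩
  mem_jacobson b hb :=
    Ring.op_mem_jacobson (h.mem_jacobson b.unop fun i ↦ ((p i).opMatrix_eq_zero_iff b).1 (hb i))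

/-- Lifts of the central idempotents of `B / J(B)`. -/
theorem exists_lift_single : ∃ a : Fin n → B,
    (∀ i b, p i b = 0 → b * a i ∈ Ring.jacobson B) ∧
    (∀ i b, p i b = 0 → a i * b ∈ Ring.jacobson B) ∧ 1 - ∑ i, a i ∈ Ring.jacobson B := by
  choose a ha using fun i ↦ h.exists_forall_eq (Pi.single i 1)
  refine ⟨a, fun i b hb ↦ h.mem_jacobson _ fun k ↦ ?_, fun i b hb ↦ h.mem_jacobson _ fun k ↦ ?_,
    h.mem_jacobson _ fun k ↦ ?_⟩
  · rcases eq_or_ne k i with rfl | hki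
    · rw [map_mul, hb, zero_mul]
    · rw [map_mul, ha, Pi.single_eq_of_ne hki, mul_zero]
  · rcases eq_or_ne k i with rfl | hki
    · rw [map_mul, hb, mul_zero]
    · rw [map_mul, ha, Pi.single_eq_of_ne hki, zero_mul]
  · rw [map_sub, map_one, map_sum, Finset.sum_eq_single k, ha, Pi.single_eq_same, sub_self]
    · intro i _ hik
      rw [ha, Pi.single_eq_of_ne hik.symm]
    · simp

/-- The radical kills `S`, so the lifts `a i` sum to the identity on `S`. Some `a i • t` is nonzero,
hence generates `S`, and the kernel of `p i` multiplies `a i` into the radical. -/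
theorem exists_forall_smul_eq_zero (S : Type*) [AddCommGroup S] [Module B S]
    [IsSimpleModule B S] : ∃ i, ∀ b, p i b = 0 → ∀ s : S, b • s = 0 := by
  obtain ⟨a, ha, -, ha1⟩ := h.exists_lift_single
  have hJ : ∀ b ∈ Ring.jacobson B, ∀ s : S, b • s = 0 := fun b hb s ↦
    Module.mem_annihilator.1 (IsSemisimpleModule.jacobson_le_annihilator B S hb) s
  have : Nontrivial S := IsSimpleModule.nontrivial B S
  obtain ⟨t, ht⟩ := exists_ne (0 : S)
  obtain ⟨i, hi⟩ : ∃ i, a i • t ≠ 0 := by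
    by_contra! hc
    have := hJ _ ha1 t
    rw [sub_smul, one_smul, Finset.sum_smul, Finset.sum_eq_zero fun i _ ↦ hc i, sub_zero] at this
    exact ht this
  refine ⟨i, fun b hb s ↦ ?_⟩
  obtain ⟨c, rfl⟩ := IsSimpleModule.toSpanSingleton_surjective B hi s
  rw [LinearMap.toSpanSingleton_apply, ← mul_smul, ← mul_smul]
  exact hJ _ (ha i _ (by rw [map_mul, hb, zero_mul])) t

end IsWedderburnFamily

/-- The quotient by a maximal left ideal above the kernel of `p` works, because that kernel is
two-sided. -/
theorem exists_isSimpleModule_of_surjective_matrix {B : Type u} [Ring B] {m : ℕ} [NeZero m]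
    {D : Type*} [DivisionRing D] (p : B →+* Matrix (Fin m) (Fin m) D) :
    ∃ (S : Type u) (_ : AddCommGroup S) (_ : Module B S), IsSimpleModule B S ∧
      ∀ b, p b = 0 → ∀ s : S, b • s = 0 := by
  obtain ⟨M, hM, hpM⟩ := Ideal.exists_le_maximal (RingHom.ker p) (RingHom.ker_ne_top p)
  refine ⟨B ⧸ M, inferInstance, inferInstance, isSimpleModule_iff_isCoatom.2 hM.out, ?_⟩
  intro b hb s
  obtain ⟨c, rfl⟩ := Submodule.Quotient.mk_surjective M s
  rw [← Submodule.Quotient.mk_smul, Submodule.Quotient.mk_eq_zero]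
  exact hpM (by rw [RingHom.mem_ker, smul_eq_mul, map_mul, hb, zero_mul])

/-! ### Linking factors through bimodules -/

/-- An element contained in every nonzero two-sided ideal is killed by the radical. -/
theorem Ring.jacobson_mul_eq_zero {C : Type*} [Ring C] [IsNoetherianRing C] {x : C}
    (hx : ∀ T : TwoSidedIdeal C, T ≠ ⊥ → x ∈ T) {r : C} (hr : r ∈ Ring.jacobson C) : r * x = 0 := by
  let W := TwoSidedIdeal.span {x}
  have hxW : x ∈ W := TwoSidedIdeal.subset_span rfl
  have hmem : r * x ∈ Ring.jacobson C * W.asIdeal :=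
    Ideal.mul_mem_mul hr (TwoSidedIdeal.mem_asIdeal.2 hxW)
  by_contra hrx
  -- If the product ideal is nonzero it contains `x`, hence all of `W`; Nakayama then gives `W = 0`.
  have hT : x ∈ (Ring.jacobson C * W.asIdeal).toTwoSided := hx _ fun h0 ↦ hrx <| by
    rwa [← Ideal.mem_toTwoSided, h0, TwoSidedIdeal.mem_bot] at hmem
  have hle : W.asIdeal ≤ Ring.jacobson C * W.asIdeal := by
    intro w hw
    exact Ideal.mem_toTwoSided.1 (TwoSidedIdeal.span_le.2 (by simpa using hT) hw)
  have := Submodule.FG.eq_bot_of_le_jacobson_smul (IsNoetherian.noetherian W.asIdeal) hle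
  have hx0 : x ∈ W.asIdeal := TwoSidedIdeal.mem_asIdeal.2 hxW
  rw [this, Ideal.mem_bot] at hx0
  exact hrx (by rw [hx0, mul_zero])

theorem Ring.mul_jacobson_eq_zero {C : Type*} [Ring C] [IsNoetherianRing Cᵐᵒᵖ] {x : C}
    (hx : ∀ T : TwoSidedIdeal C, T ≠ ⊥ → x ∈ T) {r : C} (hr : r ∈ Ring.jacobson C) : x * r = 0 := by
  have := Ring.jacobson_mul_eq_zero (x := MulOpposite.op x) (fun T hT ↦ ?_)
    (Ring.op_mem_jacobson hr)
  · exact MulOpposite.op_injective this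
  · refine TwoSidedIdeal.mem_unop_iff.1 (hx _ fun h ↦ hT ?_)
    exact TwoSidedIdeal.opOrderIso.symm.injective (h.trans (map_bot _).symm)

theorem Module.Finite.compHom_of_surjective {B C W : Type*} [Ring B] [Ring C] [AddCommGroup W]
    [Module C W] [Module.Finite C W] {f : B →+* C} (hf : Function.Surjective f) :
    letI := Module.compHom W f
    Module.Finite B W := by
  let := Module.compHom W f
  obtain ⟨s, hs⟩ := (Module.Finite.fg_top : (⊤ : Submodule C W).FG)
  refine ⟨s, eq_top_iff.2 fun w _ ↦ ?_⟩
  have hw : w ∈ Submodule.span C (s : Set W) := hs ▸ Submodule.mem_top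
  induction hw using Submodule.span_induction with
  | mem w hw => exact Submodule.subset_span hw
  | zero => exact zero_mem _
  | add v w _ _ hv hw => exact add_mem (hv trivial) (hw trivial)
  | smul c w _ hw =>
    obtain ⟨b, rfl⟩ := hf c
    exact Submodule.smul_mem _ b (hw trivial)

theorem TwoSidedIdeal.wellFoundedGT {R : Type*} [Ring R] [IsNoetherianRing R] :
    WellFoundedGT (TwoSidedIdeal R) := by
  let φ : TwoSidedIdeal R → Ideal R := TwoSidedIdeal.asIdeal
  have hφ : StrictMono φ := TwoSidedIdeal.asIdeal.monotone.strictMono_of_injective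
    fun I J h ↦ SetLike.coe_injective (congrArg (fun K : Ideal R ↦ (K : Set R)) h)
  exact hφ.wellFoundedGT

/-- Let `B → C` be surjective and let `y ≠ 0` in `C` be killed from the left by the kernel of
`B → M_m(D)` and from the right by the kernel of `B → M_m'(D')`. Then `D` and `D'` have the same
characteristic and essentially the same cardinality. -/
theorem charCard_eq_of_mul_eq_zero {B C : Type u} [Ring B] [Ring C] [IsNoetherianRing C]
    [IsNoetherianRing Cᵐᵒᵖ] {f : B →+* C} (hf : Function.Surjective f) {m m' : ℕ} {D D' : Type u}
    [DivisionRing D] [DivisionRing D'] {p : B →+* Matrix (Fin m) (Fin m) D}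
    {p' : B →+* Matrix (Fin m') (Fin m') D'} (hp : Function.Surjective p)
    (hp' : Function.Surjective p'.opMatrix) {y : C} (hy : y ≠ 0)
    (hyp : ∀ b, p b = 0 → f b * y = 0) (hyp' : ∀ b, p' b = 0 → y * f b = 0) :
    charCard D = charCard D' := by
  let W := TwoSidedIdeal.span {y}
  have hyW : y ∈ W := TwoSidedIdeal.subset_span rfl
  -- Annihilation passes from `y` to all of `W` since the kernel of `p` is a two-sided ideal.
  have hW : ∀ w ∈ W, ∀ b, p b = 0 → f b * w = 0 := by
    intro w hw
    induction hw using TwoSidedIdeal.span_induction with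
    | mem w hw => rwa [Set.mem_singleton_iff.1 hw]
    | zero => simp
    | add v w _ _ hv hw => exact fun b hb ↦ by rw [mul_add, hv b hb, hw b hb, add_zero]
    | neg w _ hw => exact fun b hb ↦ by rw [mul_neg, hw b hb, neg_zero]
    | left_absorb c w _ hw =>
      intro b hb
      obtain ⟨c, rfl⟩ := hf c
      rw [← mul_assoc, ← map_mul, hw _ (by rw [map_mul, hb, zero_mul])]
    | right_absorb c w _ hw => exact fun b hb ↦ by rw [← mul_assoc, hw b hb, zero_mul]
  have hW' : ∀ w ∈ W, ∀ b, p' b = 0 → w * f b = 0 := by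
    intro w hw
    induction hw using TwoSidedIdeal.span_induction with
    | mem w hw => rwa [Set.mem_singleton_iff.1 hw]
    | zero => simp
    | add v w _ _ hv hw => exact fun b hb ↦ by rw [add_mul, hv b hb, hw b hb, add_zero]
    | neg w _ hw => exact fun b hb ↦ by rw [neg_mul, hw b hb, neg_zero]
    | left_absorb c w _ hw => exact fun b hb ↦ by rw [mul_assoc, hw b hb, mul_zero]
    | right_absorb c w _ hw =>
      intro b hb
      obtain ⟨c, rfl⟩ := hf c
      rw [mul_assoc, ← map_mul, hw _ (by rw [map_mul, hb, mul_zero])]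
  have hf' : Function.Surjective (RingHom.op f) := fun c ↦ by
    obtain ⟨b, hb⟩ := hf c.unop
    exact ⟨MulOpposite.op b, MulOpposite.unop_injective hb⟩
  let := Module.compHom W.asIdeal f
  let := Module.compHom W.asIdealOpposite (RingHom.op f)
  have : Module.Finite B W.asIdeal := Module.Finite.compHom_of_surjective hf
  have : Module.Finite Bᵐᵒᵖ W.asIdealOpposite := Module.Finite.compHom_of_surjective hf'
  have : Nontrivial W.asIdeal :=
    ⟨⟨y, TwoSidedIdeal.mem_asIdeal.2 hyW⟩, 0, fun h ↦ hy (congrArg Subtype.val h)⟩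
  rw [← charCard_mulOpposite D']
  -- The same additive group is read once as a left and once as a right module.
  refine charCard_eq_of_addEquiv (W := W.asIdeal) (W' := W.asIdealOpposite) hp hp'
    { toFun := fun w ↦ ⟨MulOpposite.op w.1, TwoSidedIdeal.mem_asIdealOpposite.2
        (TwoSidedIdeal.mem_asIdeal.1 w.2)⟩
      invFun := fun w ↦ ⟨w.1.unop, TwoSidedIdeal.mem_asIdeal.2
        (TwoSidedIdeal.mem_asIdealOpposite.1 w.2)⟩
      left_inv := fun _ ↦ rfl
      right_inv := fun _ ↦ rfl
      map_add' := fun _ _ ↦ rfl } ?_ ?_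
  · exact fun b hb w ↦ Subtype.ext (hW _ (TwoSidedIdeal.mem_asIdeal.1 w.2) b hb)
  · exact fun b hb w ↦ Subtype.ext <| MulOpposite.unop_injective <|
      hW' _ (TwoSidedIdeal.mem_asIdealOpposite.1 w.2) b.unop ((p'.opMatrix_eq_zero_iff b).1 hb)

namespace IsWedderburnFamily

variable {B : Type u} [Ring B] {n : ℕ} {μ : Fin n → ℕ} {D : Fin n → Type u}
  [∀ i, DivisionRing (D i)] {p : ∀ i, B →+* Matrix (Fin (μ i)) (Fin (μ i)) (D i)}
  (h : IsWedderburnFamily p) [IsNoetherianRing B] [IsNoetherianRing Bᵐᵒᵖ]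
include h

/-- The elements `e` and `e'` restrict which factors may occur; this is what later separates an
idempotent from its complement. -/
theorem exists_charCard_eq {x e e' : B} (hx : x ≠ 0) (hex : e * x = x) (hxe : x * e' = x) :
    ∃ i j, p i e ≠ 0 ∧ p j e' ≠ 0 ∧ charCard (D i) = charCard (D j) := by
  have := TwoSidedIdeal.wellFoundedGT (R := B)
  -- By maximality of `L`, the image of `x` lies in every nonzero two-sided ideal of the quotient.
  obtain ⟨L, hxL, hL⟩ := WellFounded.has_min (wellFounded_gt (α := TwoSidedIdeal B)) {L | x ∉ L}
    ⟨⊥, by simpa [TwoSidedIdeal.mem_bot] using hx⟩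
  let C := B ⧸ L.asIdeal
  let f : B →+* C := Ideal.Quotient.mk _
  have hf : Function.Surjective f := Ideal.Quotient.mk_surjective
  have : IsNoetherianRing C := isNoetherianRing_of_surjective _ _ f hf
  have : IsNoetherianRing Cᵐᵒᵖ := isNoetherianRing_of_surjective _ _ (RingHom.op f) fun c ↦ by
    obtain ⟨b, hb⟩ := hf c.unop
    exact ⟨MulOpposite.op b, MulOpposite.unop_injective hb⟩
  have hfx : f x ≠ 0 := fun h0 ↦ hxL <|
    TwoSidedIdeal.mem_asIdeal.1 (Ideal.Quotient.eq_zero_iff_mem.1 h0)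
  have hmin : ∀ T : TwoSidedIdeal C, T ≠ ⊥ → f x ∈ T := by
    intro T hT
    by_contra hxT
    refine hL (T.comap f) (fun h ↦ hxT ((TwoSidedIdeal.mem_comap f).1 h)) (lt_of_le_of_ne ?_ ?_)
    · intro b hb
      rw [TwoSidedIdeal.mem_comap, show f b = 0 from
        Ideal.Quotient.eq_zero_iff_mem.2 (TwoSidedIdeal.mem_asIdeal.2 hb)]
      exact T.zero_mem
    · intro hLT
      refine hT (eq_bot_iff.2 fun t ht ↦ ?_)
      obtain ⟨b, rfl⟩ := hf t
      rw [TwoSidedIdeal.mem_bot]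
      exact Ideal.Quotient.eq_zero_iff_mem.2
        (TwoSidedIdeal.mem_asIdeal.2 (hLT ▸ (TwoSidedIdeal.mem_comap f).2 ht))
  have hJ : ∀ r ∈ Ring.jacobson B, f r * f x = 0 := fun r hr ↦
    Ring.jacobson_mul_eq_zero hmin (Ring.map_mem_jacobson hf hr)
  have hJ' : ∀ r ∈ Ring.jacobson B, f x * f r = 0 := fun r hr ↦
    Ring.mul_jacobson_eq_zero hmin (Ring.map_mem_jacobson hf hr)
  obtain ⟨a, ha, ha', ha1⟩ := h.exists_lift_single
  -- The `a i` sum to `1` modulo the radical, which kills `f x`, so some Peirce component survives.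
  obtain ⟨i, hi⟩ : ∃ i, f (a i * e) * f x ≠ 0 := by
    by_contra! hc
    have := hJ _ (Ideal.mul_mem_right e _ ha1)
    rw [sub_mul, one_mul, map_sub, sub_mul, ← map_mul, hex, Finset.sum_mul, map_sum,
      Finset.sum_mul, Finset.sum_eq_zero fun i _ ↦ hc i, sub_zero] at this
    exact hfx this
  obtain ⟨j, hj⟩ : ∃ j, f (a i * e) * f x * f (e' * a j) ≠ 0 := by
    by_contra! hc
    have := hJ' _ (Ideal.mul_mem_left _ e' ha1)
    rw [mul_sub, mul_one, map_sub, mul_sub, ← map_mul, hxe, Finset.mul_sum, map_sum,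
      sub_eq_zero] at this
    rw [this, Finset.mul_sum, Finset.mul_sum] at hi
    refine hi (Finset.sum_eq_zero fun j _ ↦ ?_)
    rw [← mul_assoc]
    exact hc j
  refine ⟨i, j, fun hie ↦ hi (hJ _ (ha' i e hie)), fun hje ↦ hj ?_,
    charCard_eq_of_mul_eq_zero hf (h.surjective i) (h.op.surjective j) hj ?_ ?_⟩
  · rw [mul_assoc, hJ' _ (ha j e' hje), mul_zero]
  · intro b hb
    rw [← mul_assoc, ← mul_assoc, ← map_mul, ← mul_assoc,
      hJ _ (Ideal.mul_mem_right e _ (ha i b hb)), zero_mul]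
  · intro b hb
    rw [mul_assoc, ← map_mul f (e' * a j), mul_assoc e', mul_assoc,
      hJ' _ (Ideal.mul_mem_left _ e' (ha' j b hb)), mul_zero]

theorem charCard_eq_of_isIndecomposableRing (hB : IsIndecomposableRing B) (hS : IsSemiperfectRing B)
    (hμ : ∀ i, NeZero (μ i)) (i j : Fin n) : charCard (D i) = charCard (D j) := by
  classical
  -- This selects the factors sharing the invariant of `D i`.
  obtain ⟨a, ha⟩ := h.exists_forall_eq fun k ↦ if charCard (D k) = charCard (D i) then 1 else 0
  obtain ⟨e, he, hea⟩ := hS.exists_isIdempotentElem (a := a) <| h.mem_jacobson _ fun k ↦ by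
    rw [map_sub, map_mul, ha]
    split_ifs <;> simp
  have hpe k : p k e = if charCard (D k) = charCard (D i) then 1 else 0 := by
    rw [← ha, ← sub_eq_zero, ← map_sub, h.map_eq_zero k hea]
  have key : ∀ e e' : B, IsIdempotentElem e → IsIdempotentElem e' →
      (∀ k l, p k e ≠ 0 → p l e' ≠ 0 → charCard (D k) ≠ charCard (D l)) → ∀ b, e * b * e' = 0 := by
    intro e e' he he' H b
    by_contra hb
    obtain ⟨k, l, hk, hl, hkl⟩ := h.exists_charCard_eq (e := e) (e' := e') hb
      (by rw [← mul_assoc, ← mul_assoc, he.eq]) (by rw [mul_assoc, he'.eq])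
    exact H k l hk hl hkl
  have h₁ k (hk : p k e ≠ 0) : charCard (D k) = charCard (D i) := by
    by_contra h; exact hk (by rw [hpe, if_neg h])
  have h₂ k (hk : p k (1 - e) ≠ 0) : charCard (D k) ≠ charCard (D i) := by
    intro h; exact hk (by rw [map_sub, hpe, if_pos h, map_one, sub_self])
  rcases hB.eq_zero_or_eq_one he
    (key _ _ he he.one_sub fun k l hk hl h ↦ h₂ l hl (h.symm.trans (h₁ k hk)))
    (key _ _ he.one_sub he fun k l hk hl h ↦ h₂ k hk (h.trans (h₁ l hl))) with rfl | rfl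
  · have := hpe i
    rw [map_zero, if_pos rfl] at this
    exact absurd this zero_ne_one
  · exact (h₁ j (by rw [map_one]; exact one_ne_zero)).symm

end IsWedderburnFamily

/-! ### From the division rings to finite length modules -/

namespace IsWedderburnFamily

variable {B : Type u} [Ring B] {n : ℕ} {μ : Fin n → ℕ} {D : Fin n → Type u}
  [∀ i, DivisionRing (D i)] {p : ∀ i, B →+* Matrix (Fin (μ i)) (Fin (μ i)) (D i)}
  (h : IsWedderburnFamily p)
include h

theorem finite_of_hasFiniteSimpleModule (hB : HasFiniteSimpleModule B) : ∃ i, Finite (D i) := by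
  obtain ⟨S, _, _, _, _⟩ := hB
  have : Nontrivial S := IsSimpleModule.nontrivial B S
  obtain ⟨i, hi⟩ := h.exists_forall_smul_eq_zero S
  exact ⟨i, (finite_iff_of_surjective_matrix (h.surjective i) hi).1 ‹_›⟩

theorem hasFiniteSimpleModule (i : Fin n) [NeZero (μ i)] [Finite (D i)] :
    HasFiniteSimpleModule B := by
  obtain ⟨S, _, _, _, hS⟩ := exists_isSimpleModule_of_surjective_matrix (p i)
  have : Nontrivial S := IsSimpleModule.nontrivial B S
  exact ⟨S, _, _, ‹_›, (finite_iff_of_surjective_matrix (h.surjective i) hS).2 ‹_›⟩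

theorem finiteLengthModulesFinite (hD : ∀ i, Finite (D i)) : FiniteLengthModulesFinite B := by
  intro M _ _ hM
  induction hM with
  | of_subsingleton => infer_instance
  | @of_simple_quotient M _ _ N _ _ ih =>
    have : Nontrivial (M ⧸ N) := IsSimpleModule.nontrivial B _
    obtain ⟨i, hi⟩ := h.exists_forall_smul_eq_zero (M ⧸ N)
    have : Finite (M ⧸ N) := (finite_iff_of_surjective_matrix (h.surjective i) hi).2 (hD i)
    have : Finite (M ⧸ N.toAddSubgroup) := inferInstanceAs (Finite (M ⧸ N))
    have : Finite N.toAddSubgroup := ih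
    exact Finite.of_equiv _
      (AddSubgroup.addGroupEquivQuotientProdAddSubgroup (s := N.toAddSubgroup)).symm

theorem finiteLengthModulesCard {κ : Cardinal.{u}} (hκ : ℵ₀ ≤ κ) (hD : ∀ i, #(D i) = κ) :
    FiniteLengthModulesCard B κ := by
  intro M _ _ hM' hM
  -- The zero module must be admitted, since submodules in the induction may vanish.
  suffices Subsingleton M ∨ #M = κ from this.resolve_left (not_subsingleton M)
  clear hM'
  induction hM with
  | of_subsingleton => exact Or.inl inferInstance
  | @of_simple_quotient M _ _ N _ _ ih =>
    have : Nontrivial (M ⧸ N) := IsSimpleModule.nontrivial B _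
    obtain ⟨i, hi⟩ := h.exists_forall_smul_eq_zero (M ⧸ N)
    have : Infinite (D i) := Cardinal.infinite_iff.2 ((hD i).symm ▸ hκ)
    have hq : #(M ⧸ N) = κ := (mk_eq_of_surjective_matrix (h.surjective i) hi).trans (hD i)
    have hM : #M = #(M ⧸ N) * #N :=
      Cardinal.mk_congr (AddSubgroup.addGroupEquivQuotientProdAddSubgroup (s := N.toAddSubgroup))
    right
    rw [hM, hq]
    rcases ih with hN | hN
    · have := Unique.mk' N
      rw [Cardinal.mk_eq_one, mul_one]
    · rw [hN, Cardinal.mul_eq_self hκ]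

theorem simpleEndChar {c : ℕ} (hD : ∀ i, CharP (D i) c) : SimpleEndChar B c := by
  intro S _ _ _
  have : Nontrivial S := IsSimpleModule.nontrivial B S
  obtain ⟨i, hi⟩ := h.exists_forall_smul_eq_zero S
  refine ⟨fun n ↦ ?_⟩
  rw [← (hD i).cast_eq_zero_iff n, natCast_eq_zero_iff_of_surjective_matrix (h.surjective i) hi,
    LinearMap.ext_iff]
  simp

/-- A simple module consists of the column vectors over some `D i`, and `D i` is as large as
its endomorphism ring. -/
theorem exists_equiv_of_isSimpleModule (S : Type u) [AddCommGroup S] [Module B S]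
    [IsSimpleModule B S] :
    ∃ i, Nonempty ((Fin (μ i) → D i) ≃ S) ∧ Nonempty (D i ≃ Module.End B S) := by
  have : Nontrivial S := IsSimpleModule.nontrivial B S
  obtain ⟨i, hi⟩ := h.exists_forall_smul_eq_zero S
  obtain ⟨E, hE⟩ := exists_addEquiv_of_isSimpleModule (h.surjective i) hi
  have : NeZero (μ i) := ⟨fun h0 ↦ by
    have : IsEmpty (Fin (μ i)) := by rw [h0]; infer_instance
    exact not_subsingleton S E.symm.toEquiv.subsingleton⟩
  exact ⟨i, ⟨E.toEquiv⟩, nonempty_equiv_end_of_addEquiv (h.surjective i) E hE⟩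

theorem simpleEndCard {κ : Cardinal.{u}} (hD : ∀ i, #(D i) = κ) : SimpleEndCard B κ := by
  intro S _ _ _
  obtain ⟨i, -, ⟨E⟩⟩ := h.exists_equiv_of_isSimpleModule S
  rw [← hD i, Cardinal.mk_congr E]

theorem simpleCardEqEnd (hμ : ∀ i, μ i = 1) : SimpleCardEqEnd B := by
  intro S _ _ _
  obtain ⟨i, ⟨E⟩, ⟨E'⟩⟩ := h.exists_equiv_of_isSimpleModule S
  have : Unique (Fin (μ i)) := by rw [hμ i]; infer_instance
  exact Cardinal.mk_congr (E.symm.trans ((Equiv.funUnique _ _).trans E'))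

/-- Comparing cardinalities gives $|D|^{\mu}=|D|$ with $|D|$ finite and greater than one. -/
theorem eq_one_of_simpleCardEqEnd (hB : SimpleCardEqEnd B) (i : Fin n) [NeZero (μ i)]
    [Finite (D i)] : μ i = 1 := by
  obtain ⟨S, _, _, _, hS⟩ := exists_isSimpleModule_of_surjective_matrix (p i)
  obtain ⟨E, hE⟩ := exists_addEquiv_of_isSimpleModule (h.surjective i) hS
  obtain ⟨E'⟩ := nonempty_equiv_end_of_addEquiv (h.surjective i) E hE
  obtain ⟨F⟩ := Cardinal.eq.1 (hB S ‹_›)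
  have := Nat.card_congr (E.toEquiv.trans (F.trans E'.symm))
  rw [Nat.card_fun, Nat.card_fin] at this
  exact Nat.pow_right_injective (Finite.one_lt_card (α := D i)) (by simpa using this)

end IsWedderburnFamily

/-! ### Properties of blocks and the main theorem -/

theorem IsBasicRing.simpleCardEqEnd {B : Type u} [Ring B] (hB : IsBasicRing B) :
    SimpleCardEqEnd B ∧ SimpleCardEqEnd Bᵐᵒᵖ := by
  obtain ⟨n, μ, D, _, ⟨e⟩, hμ⟩ := hB
  have h := isWedderburnFamily_of_ringEquiv e
  exact ⟨h.simpleCardEqEnd hμ, h.op.simpleCardEqEnd hμ⟩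

theorem IsIndecomposableRing.properties {B : Type u} [Ring B] [IsNoetherianRing B]
    [IsNoetherianRing Bᵐᵒᵖ] (hB : IsIndecomposableRing B) (hS : IsSemiperfectRing B) :
    (HasFiniteSimpleModule B ∨ HasFiniteSimpleModule Bᵐᵒᵖ →
      FiniteLengthModulesFinite B ∧ FiniteLengthModulesFinite Bᵐᵒᵖ ∧
      (SimpleCardEqEnd B ↔ IsBasicRing B) ∧ (SimpleCardEqEnd Bᵐᵒᵖ ↔ IsBasicRing B)) ∧
    (¬ (HasFiniteSimpleModule B ∨ HasFiniteSimpleModule Bᵐᵒᵖ) →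
      ∃ κ : Cardinal.{u}, ℵ₀ ≤ κ ∧
        FiniteLengthModulesCard B κ ∧ FiniteLengthModulesCard Bᵐᵒᵖ κ ∧
        SimpleEndCard B κ ∧ SimpleEndCard Bᵐᵒᵖ κ) ∧
    ∃ c : ℕ, SimpleEndChar B c ∧ SimpleEndChar Bᵐᵒᵖ c := by
  have := hS.1
  have := hB.1
  obtain ⟨n, D, μ, _, hμ, ⟨e⟩⟩ :=
    IsSemisimpleRing.exists_ringEquiv_pi_matrix_divisionRing (B ⧸ Ring.jacobson B)
  have h := isWedderburnFamily_of_ringEquiv e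
  have hD := h.charCard_eq_of_isIndecomposableRing hB hS hμ
  have hDop i j : charCard (D i)ᵐᵒᵖ = charCard (D j) := (charCard_mulOpposite _).trans (hD i j)
  -- Without factors, `1` would lie in the radical of the nonzero ring `B`.
  obtain ⟨i₀⟩ : Nonempty (Fin n) := by
    by_contra hn
    rw [not_nonempty_iff] at hn
    refine (Ring.jacobson_lt_top B).ne ((Ideal.eq_top_iff_one _).2 (h.mem_jacobson 1 hn.elim))
  refine ⟨fun hfin ↦ ?_, fun hinf ↦ ?_, ringChar (D i₀), ?_, ?_⟩
  · have hf : ∀ i, Finite (D i) := by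
      rcases hfin with hfin | hfin
      · obtain ⟨j, hj⟩ := h.finite_of_hasFiniteSimpleModule hfin
        exact fun i ↦ (finite_iff_of_charCard_eq (hD i j)).2 hj
      · obtain ⟨j, hj⟩ := h.op.finite_of_hasFiniteSimpleModule hfin
        exact fun i ↦ (finite_iff_of_charCard_eq (hDop j i)).1 hj
    have hfop : ∀ i, Finite (D i)ᵐᵒᵖ := fun i ↦
      Finite.of_equiv _ MulOpposite.opEquiv
    exact ⟨h.finiteLengthModulesFinite hf, h.op.finiteLengthModulesFinite hfop,
      ⟨fun hc ↦ ⟨n, μ, D, _, ⟨e⟩, fun i ↦ h.eq_one_of_simpleCardEqEnd hc i⟩,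
        fun hb ↦ hb.simpleCardEqEnd.1⟩,
      -- Passing to the opposite ring keeps the matrix sizes, so right modules also detect that `B`
      -- is basic.
      ⟨fun hc ↦ ⟨n, μ, D, _, ⟨e⟩, fun i ↦ h.op.eq_one_of_simpleCardEqEnd hc i⟩,
        fun hb ↦ hb.simpleCardEqEnd.2⟩⟩
  · have : Infinite (D i₀) := not_finite_iff_infinite.1 fun _ ↦
      hinf (Or.inl (h.hasFiniteSimpleModule i₀))
    have hκ := Cardinal.aleph0_le_mk (D i₀)
    have hc : ∀ i, #(D i) = #(D i₀) := fun i ↦ (mk_eq_of_charCard_eq (hD i₀ i)).symm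
    have hcop : ∀ i, #(D i)ᵐᵒᵖ = #(D i₀) := fun i ↦ (mk_eq_of_charCard_eq (hDop i i₀).symm).symm
    exact ⟨#(D i₀), hκ, h.finiteLengthModulesCard hκ hc, h.op.finiteLengthModulesCard hκ hcop,
      h.simpleEndCard hc, h.op.simpleEndCard hcop⟩
  · exact h.simpleEndChar fun i ↦ ringChar.of_eq (ringChar_eq_of_charCard_eq (hD i i₀))
  · exact h.op.simpleEndChar fun i ↦ ringChar.of_eq (ringChar_eq_of_charCard_eq (hDop i i₀))

theorem mainTheorem1 (R : Type u) [Ring R] [IsNoetherianRing R] [IsNoetherianRing Rᵐᵒᵖ]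
    (hR : IsSemiperfectRing R) :
    ∃ (n : ℕ) (B : Fin n → Type u) (_ : ∀ i, Ring (B i)),
      Nonempty (R ≃+* (∀ i, B i)) ∧
      ∀ i, IsIndecomposableRing (B i) ∧
        (HasFiniteSimpleModule (B i) ∨ HasFiniteSimpleModule (B i)ᵐᵒᵖ →
          FiniteLengthModulesFinite (B i) ∧ FiniteLengthModulesFinite (B i)ᵐᵒᵖ ∧
          (SimpleCardEqEnd (B i) ↔ IsBasicRing (B i)) ∧
          (SimpleCardEqEnd (B i)ᵐᵒᵖ ↔ IsBasicRing (B i))) ∧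
        (¬ (HasFiniteSimpleModule (B i) ∨ HasFiniteSimpleModule (B i)ᵐᵒᵖ) →
          ∃ κ : Cardinal.{u}, ℵ₀ ≤ κ ∧
            FiniteLengthModulesCard (B i) κ ∧ FiniteLengthModulesCard (B i)ᵐᵒᵖ κ ∧
            SimpleEndCard (B i) κ ∧ SimpleEndCard (B i)ᵐᵒᵖ κ) ∧
        ∃ c : ℕ, SimpleEndChar (B i) c ∧ SimpleEndChar (B i)ᵐᵒᵖ c := by
  obtain ⟨ι, _, B, _, ⟨e⟩, hB⟩ :=
    exists_ringEquiv_pi_isIndecomposableRing (RingHom.id R) Function.surjective_id hR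
  obtain ⟨n, ⟨σ⟩⟩ := Finite.exists_equiv_fin ι
  refine ⟨n, fun i ↦ B (σ.symm i), fun i ↦ inferInstance,
    ⟨e.trans (RingEquiv.piCongrLeft' B σ)⟩, fun i ↦ ?_⟩
  obtain ⟨hind, hS, g, hg⟩ := hB (σ.symm i)
  have : IsNoetherianRing (B (σ.symm i)) := isNoetherianRing_of_surjective _ _ g hg
  have : IsNoetherianRing (B (σ.symm i))ᵐᵒᵖ :=
    isNoetherianRing_of_surjective _ _ (RingHom.op g) fun c ↦ by
      obtain ⟨r, hr⟩ := hg c.unop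
      exact ⟨MulOpposite.op r, MulOpposite.unop_injective hr⟩
  exact ⟨hind, hind.properties hS⟩
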